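/- **Setting.** A seller has a finite set $I$ of $n$ items and faces $m$ buyers $1,\dots,m$ with valuations $v_1,\dots,v_m : 2^I\to\mathbb R$. A valuation $v$ is *XOS* if there are finitely many (at least one) non-negative additive functions $a_1,\dots,a_\ell$ on $2^I$ with $v(S)=\max_j a_j(S)$ for all $S\subseteq I$; it is *$\ell$-XOS* if at most $\ell$ such functions suffice. A *static uniform price* is a number $p\ge 0$ that is put on every item and never changed. The buyers arrive one after the other in some order; each buyer $b$, on her arrival, buys a set $S$ of still unsold items that maximizes $v_b(S)-p|S|$ over all sets of unsold items (ties may be broken arbitrarily). The *revenue* is $p$ times the number of items sold. $\mathrm{OPT}$ is the maximum of $\sum_b v_b(T_b)$ over all tuples $(T_1,\dots,T_m)$ of pairwise disjoint subsets of $I$. **Theorem.** There are an absolute constant $c>0$ and an $N\in\mathbb N$ such that for every $n\ge N$ there is an instance with $n$ items and finitely many buyers with XOS valuations, with $\mathrm{OPT}>0$, such that for every arrival order of the buyers, every static uniform price $p\ge 0$ (which may depend on the whole instance and on the arrival order) and every way of breaking ties, the revenue is at most $$\frac{\mathrm{OPT}}{2^{\,c\sqrt{\log n}}}.$$ Moreover,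 for every $n\ge N$ such an instance (with the same $c$, and again for every arrival order, price and tie-breaking) exists in which all valuations are $3$-XOS, and such an instance exists in which all buyers have the same XOS valuation. (It is not claimed that one instance has both of these properties.) -/

import Mathlib

namespace ItemPricing

/-- A valuation function on subsets of a finite set `ι` of items. -/
abbrev Valuation (ι : Type) := Finset ι → ℝ

/-- `v` is the pointwise maximum of the `k` non-negative additive functions
`S ↦ ∑ i ∈ S, a j i`, `j : Fin k` (the maximum has to be attained, so `k = 0` is impossible). -/
def IsMaxOfAdditive {ι : Type} (k : ℕ) (v : Valuation ι) : Prop :=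
  ∃ a : Fin k → ι → ℝ, (∀ j i, 0 ≤ a j i) ∧
    ∀ S : Finset ι, IsGreatest (Set.range fun j : Fin k => ∑ i ∈ S, a j i) (v S)

/-- XOS valuations: maxima of finitely many non-negative additive functions.
Such functions are automatically subadditive. -/
def IsXOS {ι : Type} (v : Valuation ι) : Prop :=
  ∃ k : ℕ, IsMaxOfAdditive k v

/-- `ℓ`-XOS valuations: at most `ℓ` additive components suffice. -/
def IsXOSOfWidth {ι : Type} (l : ℕ) (v : Valuation ι) : Prop :=
  ∃ k : ℕ, k ≤ l ∧ IsMaxOfAdditive k v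

/-- The utility of the bundle `S` for a buyer with valuation `v`, at item prices `q`. -/
def utility {ι : Type} (v : Valuation ι) (q : ι → ℝ) (S : Finset ι) : ℝ :=
  v S - ∑ i ∈ S, q i

/-- `S` is one of the utility-maximizing bundles when the set `J` of items is on offer
at prices `q`. -/
def IsDemanded {ι : Type} (v : Valuation ι) (q : ι → ℝ) (J S : Finset ι) : Prop :=
  S ⊆ J ∧ ∀ T : Finset ι, T ⊆ J → utility v q T ≤ utility v q S

/-- The items that are still unsold when the `k`-th buyer in the order `σ` arrives
(`σ k` is the `k`-th buyer to arrive, `B b` is the bundle bought by buyer `b`). -/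
def unsold {n m : ℕ} (σ : Equiv.Perm (Fin m)) (B : Fin m → Finset (Fin n)) (k : Fin m) :
    Finset (Fin n) :=
  Finset.univ \ (Finset.univ.filter fun j : Fin m => j < k).biUnion fun j => B (σ j)

/-- `B` is a possible outcome of the sale with static prices `q` and arrival order `σ`: every
buyer, on her arrival, buys some utility-maximizing bundle of unsold items. Ties between such
bundles may be broken in any way. -/
def IsOutcome {n m : ℕ} (v : Fin m → Valuation (Fin n)) (q : Fin n → ℝ)
    (σ : Equiv.Perm (Fin m)) (B : Fin m → Finset (Fin n)) : Prop :=
  ∀ k : Fin m, IsDemanded (v (σ k)) q (unsold σ B k) (B (σ k))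

/-- The revenue: the sum of the prices of all sold items. -/
def revenue {n m : ℕ} (q : Fin n → ℝ) (B : Fin m → Finset (Fin n)) : ℝ :=
  ∑ b, ∑ i ∈ B b, q i

/-- An allocation gives disjoint bundles to the buyers; not all items need be allocated. -/
def IsAllocation {n m : ℕ} (T : Fin m → Finset (Fin n)) : Prop :=
  ∀ b b' : Fin m, b ≠ b' → Disjoint (T b) (T b')

/-- The social welfare of an allocation. -/
def welfare {n m : ℕ} (v : Fin m → Valuation (Fin n)) (T : Fin m → Finset (Fin n)) : ℝ :=
  ∑ b, v b (T b)

/-- The optimal social welfare `OPT`: the supremum over the finite, non-empty set of allocations,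
hence a maximum. -/
noncomputable def opt {n m : ℕ} (v : Fin m → Valuation (Fin n)) : ℝ :=
  sSup {w : ℝ | ∃ T : Fin m → Finset (Fin n), IsAllocation T ∧ w = welfare v T}

/-- `opt` is the welfare of a welfare-maximizing allocation. -/
theorem isGreatest_opt {n m : ℕ} (v : Fin m → Valuation (Fin n)) :
    IsGreatest {w : ℝ | ∃ T : Fin m → Finset (Fin n), IsAllocation T ∧ w = welfare v T}
      (opt v) := by
  have hfin : {w : ℝ | ∃ T : Fin m → Finset (Fin n), IsAllocation T ∧ w = welfare v T}.Finite :=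
    (Set.finite_range (welfare v)).subset (by
      rintro w ⟨T, -, rfl⟩
      exact ⟨T, rfl⟩)
  have hne : {w : ℝ | ∃ T : Fin m → Finset (Fin n), IsAllocation T ∧ w = welfare v T}.Nonempty :=
    ⟨_, fun _ => ∅, fun _ _ _ => Finset.disjoint_empty_left _, rfl⟩
  exact ⟨hne.csSup_mem hfin, fun w hw => le_csSup hfin.bddAbove hw⟩

/-- The instance has positive optimal social welfare and, for every arrival order, every single
non-negative price put once and for all on every item, and every resulting outcome, the revenue is
at most `OPT / α`. The price may depend on the whole instance and on the arrival order. -/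
def StaticUniformGap {n m : ℕ} (v : Fin m → Valuation (Fin n)) (α : ℝ) : Prop :=
  0 < opt v ∧
    ∀ (σ : Equiv.Perm (Fin m)) (p : ℝ), 0 ≤ p →
      ∀ B : Fin m → Finset (Fin n), IsOutcome v (fun _ => p) σ B →
        revenue (fun _ => p) B ≤ opt v / α

end ItemPricing

/-!
A single uniform price can be bad because the bundles which carry most of the welfare are lost to a
few early buyers whenever they would be worth their price. The instances below make this happen on
`K + 1` scales at once.

There are `g` buyers and, on every level `i ≤ K`, own items for each of the `g` labels, together
worth `(3 / 4) ^ i` per label, and unlabelled items. The numbers of items drop by a huge factor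
from each level to the next, so that each price is essentially relevant to one level only. A buyer
values her bundle by one of two additive components, one for each parity. The component of
parity `s` values its own items on the levels of parity `s`. On the levels of the other parity it
values the labelled items of all labels at a small amount `w i`, and it values the unlabelled items
there twice as high as the component of the other parity does. Taking level `0` alone, the optimal
welfare is at least `g`.

Consider a price well between `w j` and `w (j + 1)`. Here the own items of the levels `≤ j - 2` are
too expensive, those of the levels `≥ j` yield almost nothing, and only the sale of the own items of
level `j - 1` could give a good revenue. The first buyer is attracted by the unlabelled items; she
chooses the parity of `j`, and takes all items of the levels `j + 1, j + 3, …`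
(`LevelScheme.IsChoice.parity_of_first`). For the later buyers the component of the other parity
has then lost its higher levels and offers only `(3 / 4) ^ (j - 1)` on level `j - 1`, while the
parity of `j` still offers `(3 / 4) ^ j + (3 / 4) ^ (j + 2)`, which is more
(`LevelScheme.IsChoice.parity_of_later`). So nobody buys own items of level `j - 1`. At the
remaining prices the revenue is small for reasons of size. Altogether the revenue is at most a
fraction `(7 / 8) ^ K` of the optimum (`LevelScheme.staticUniformGap_geom`), while there are only
`2 ^ O(K ^ 2)` items.

If each buyer has just her own label, the valuations are maxima of two additive functions; if
each buyer may use every label, all valuations are the same. The argument only needs that a later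
buyer always finds a label not used before (`LevelScheme.HasFreshLabels`), which holds in both
cases and for every arrival order.
-/

namespace ItemPricing

/-! ### Maxima of additive functions -/

/-- The maximum of the additive functions with item values `a k`, `k ∈ A`. -/
noncomputable def maxAdditive {ι κ : Type} (A : Finset κ) (hA : A.Nonempty) (a : κ → ι → ℝ) :
    Valuation ι :=
  fun S => A.sup' hA fun k => ∑ i ∈ S, a k i

theorem sum_le_maxAdditive {ι κ : Type} {A : Finset κ} (hA : A.Nonempty) (a : κ → ι → ℝ)
    {k : κ} (hk : k ∈ A) (S : Finset ι) : ∑ i ∈ S, a k i ≤ maxAdditive A hA a S :=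
  Finset.le_sup' (fun k => ∑ i ∈ S, a k i) hk

theorem exists_maxAdditive_eq {ι κ : Type} {A : Finset κ} (hA : A.Nonempty) (a : κ → ι → ℝ)
    (S : Finset ι) : ∃ k ∈ A, maxAdditive A hA a S = ∑ i ∈ S, a k i :=
  Finset.exists_mem_eq_sup' hA _

theorem isMaxOfAdditive_maxAdditive {ι κ : Type} {A : Finset κ} (hA : A.Nonempty)
    (a : κ → ι → ℝ) (ha : ∀ k i, 0 ≤ a k i) : IsMaxOfAdditive A.card (maxAdditive A hA a) := by
  refine ⟨fun j i => a (A.equivFin.symm j) i, fun j i => ha _ i, fun S => ⟨?_, ?_⟩⟩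
  · obtain ⟨k, hk, h⟩ := exists_maxAdditive_eq hA a S
    exact ⟨A.equivFin ⟨k, hk⟩, by simp [h]⟩
  · rintro _ ⟨j, rfl⟩
    exact sum_le_maxAdditive hA a (A.equivFin.symm j).2 S

/-- A buyer whose valuation is a maximum of additive functions picks one of them and buys, among
the items on offer, those which it values above the price, no item which it values below the
price, and this choice is optimal among all additive functions and all bundles on offer. -/
theorem IsDemanded.exists_component {ι κ : Type} {A : Finset κ} {hA : A.Nonempty}
    {a : κ → ι → ℝ} {p : ℝ} {J S : Finset ι}
    (h : IsDemanded (maxAdditive A hA a) (fun _ => p) J S) :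
    ∃ k ∈ A, (∀ x ∈ S, p ≤ a k x) ∧ (∀ x ∈ J, p < a k x → x ∈ S) ∧
      ∀ l ∈ A, ∀ T ⊆ J, ∑ x ∈ T, (a l x - p) ≤ ∑ x ∈ S, (a k x - p) := by
  classical
  obtain ⟨k, hk, hS⟩ := exists_maxAdditive_eq hA a S
  have key : ∀ l ∈ A, ∀ T ⊆ J, ∑ x ∈ T, (a l x - p) ≤ ∑ x ∈ S, (a k x - p) := by
    intro l hl T hT
    have h1 := h.2 T hT
    have h2 := sum_le_maxAdditive hA a hl T
    simp only [utility] at h1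
    rw [Finset.sum_sub_distrib, Finset.sum_sub_distrib]
    linarith
  refine ⟨k, hk, fun x hx => ?_, fun x hx hlt => ?_, key⟩
  · have h1 := key k hk (S.erase x) ((Finset.erase_subset _ _).trans h.1)
    have h2 := Finset.add_sum_erase S (fun x => a k x - p) hx
    linarith
  · by_contra hxS
    have h1 := key k hk (insert x S) (Finset.insert_subset hx h.1)
    rw [Finset.sum_insert hxS] at h1
    linarith

/-! ### Outcomes -/

theorem mem_unsold {n m : ℕ} {σ : Equiv.Perm (Fin m)} {B : Fin m → Finset (Fin n)} {k : Fin m}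
    {x : Fin n} : x ∈ unsold σ B k ↔ ∀ j < k, x ∉ B (σ j) := by
  simp [unsold]

theorem IsOutcome.pairwiseDisjoint {n m : ℕ} {v : Fin m → Valuation (Fin n)} {q : Fin n → ℝ}
    {σ : Equiv.Perm (Fin m)} {B : Fin m → Finset (Fin n)} (h : IsOutcome v q σ B) :
    Pairwise fun k l : Fin m => Disjoint (B (σ k)) (B (σ l)) := by
  have aux : ∀ k l : Fin m, k < l → Disjoint (B (σ k)) (B (σ l)) := fun k l hkl =>
    Finset.disjoint_right.2 fun x hx => mem_unsold.1 ((h l).1 hx) k hkl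
  intro k l hkl
  rcases lt_or_gt_of_ne hkl with h' | h'
  exacts [aux k l h', (aux l k h').symm]

/-! ### Level schemes -/

/-- The numerical data of the hard instances. There are `g` buyers and `K + 1` levels of items. On
level `i` every label `b : Fin g` owns `N i` items, and there are `M i` unlabelled items. A labelled
item of level `i` is worth `r i` to the component of its own label with the parity of `i`, and
`w i` to the components of the other parity (see `LevelScheme.value`). The levels above `K` hold worthless items. The bounds are
those which make the revenue small: `dead` and `cheap` say that `w j` exceeds the value of own
items two levels below `j`, while buying the own items of level `j - 1` at the price `w j` yields
almost nothing; `first_lt` and `later_lt` determine what the first and the later buyers prefer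
when the price is between `2 * w j` and `w (j + 1) / 2`, or between `2 * w (j + 1)` and
`w (j + 2) / 2`, respectively. -/
structure LevelScheme (K g : ℕ) where
  /-- The number of items of each label on a level. -/
  N : ℕ → ℕ
  /-- The number of unlabelled items on a level. -/
  M : ℕ → ℕ
  /-- The value of an own item. -/
  r : ℕ → ℝ
  /-- The value of a labelled item on a level of the other parity; an unlabelled item is worth
  twice as much there, and `w i` on the levels of the same parity. -/
  w : ℕ → ℝ
  /-- A bound for the price of the own items of a cheap level. -/
  δ : ℝ
  /-- A bound for the price of the own items on a level where they are ever bought. -/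
  ρ : ℝ
  r_nonneg : ∀ i, 0 ≤ r i
  w_nonneg : ∀ i, 0 ≤ w i
  r_eq_zero : ∀ i, K < i → r i = 0
  w_eq_zero : ∀ i, K < i → w i = 0
  w_mono : ∀ i j, i ≤ j → j ≤ K → w i ≤ w j
  w_pos : ∀ i, i ≤ K → 0 < w i
  dead : ∀ i j, i + 2 ≤ j → j ≤ K → 2 * r i < w j
  cheap : ∀ i j, j ≤ i + 1 → i ≤ K → j ≤ K → w j * N i ≤ δ
  two_delta_le : 2 * δ ≤ ρ
  top_le : ∀ i, i ≤ K → K ≤ i + 2 → r i * N i ≤ ρ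
  rho_nonneg : 0 ≤ ρ
  M_pos : ∀ i, i ≤ K → 0 < M i
  first_lt : ∀ j, j + 2 ≤ K →
    ∑ i ∈ Finset.range (K + 1), (N i : ℝ) * (g * w i + r i) +
      ∑ i ∈ Finset.range (K + 1), (M i : ℝ) * (if i ≤ j + 1 then 0 else 2 * w i) <
    M (j + 1) * w (j + 1) / 2
  later_lt : ∀ j, j + 3 ≤ K →
    N j * r j + ∑ i ∈ Finset.range (K + 1), (N i : ℝ) * (g * w i) + δ <
      N (j + 1) * r (j + 1) + N (j + 3) * r (j + 3)

namespace LevelScheme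

variable {K g : ℕ} (D : LevelScheme K g)

/-- The value of an item with level `i` and label `o` (`none` for the unlabelled items) in the
component with parity `s` and label `c`. -/
def value (s : ℕ) (c : Fin g) : ℕ × Option (Fin g) → ℝ
  | (i, none) => if (i + s) % 2 = 0 then D.w i else 2 * D.w i
  | (i, some b) => if (i + s) % 2 = 0 then (if b = c then D.r i else 0) else D.w i

theorem value_nonneg (s : ℕ) (c : Fin g) (l : ℕ × Option (Fin g)) : 0 ≤ D.value s c l := by
  have := D.w_nonneg l.1
  have := D.r_nonneg l.1
  rcases l with ⟨i, _ | b⟩ <;> simp only [value] <;> split_ifs <;> simp_all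

/-- A labelling of the items by levels and labels, with the numbers of items prescribed by the
scheme on the levels up to `K`. -/
structure IsLabelling {n : ℕ} (lab : Fin n → ℕ × Option (Fin g)) : Prop where
  card_some : ∀ i ≤ K, ∀ b, (Finset.univ.filter fun x => lab x = (i, some b)).card = D.N i
  card_none : ∀ i ≤ K, (Finset.univ.filter fun x => lab x = (i, none)).card = D.M i

theorem IsLabelling.sum_eq {n : ℕ} {lab : Fin n → ℕ × Option (Fin g)} {D : LevelScheme K g}
    (hlab : D.IsLabelling lab) (h : ℕ × Option (Fin g) → ℝ) (h0 : ∀ l, K < l.1 → h l = 0) :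
    ∑ x, h (lab x) = ∑ i ∈ Finset.range (K + 1),
      ((D.M i : ℝ) * h (i, none) + D.N i * ∑ b, h (i, some b)) := by
  classical
  have h1 : ∑ x, h (lab x) = ∑ x ∈ Finset.univ.filter (fun x => (lab x).1 ≤ K), h (lab x) := by
    symm
    apply Finset.sum_subset (Finset.subset_univ _)
    intro x _ hx
    apply h0
    simpa using hx
  rw [h1, ← Finset.sum_fiberwise_of_maps_to (s := Finset.univ.filter (fun x => (lab x).1 ≤ K))
    (t := Finset.range (K + 1) ×ˢ (Finset.univ : Finset (Option (Fin g)))) (g := lab)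
    (by intro x hx; simp at hx ⊢; omega)]
  rw [Finset.sum_product]
  refine Finset.sum_congr rfl fun i hi => ?_
  have hi' : i ≤ K := by simpa [Nat.lt_succ_iff] using hi
  have h2 : ∀ o : Option (Fin g),
      ∑ x ∈ (Finset.univ.filter (fun x => (lab x).1 ≤ K)).filter (fun x => lab x = (i, o)),
        h (lab x) = (Finset.univ.filter fun x => lab x = (i, o)).card * h (i, o) := by
    intro o
    have : (Finset.univ.filter (fun x => (lab x).1 ≤ K)).filter (fun x => lab x = (i, o)) =
        Finset.univ.filter fun x => lab x = (i, o) := by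
      ext x
      simp only [Finset.mem_filter, Finset.mem_univ, true_and, and_iff_right_iff_imp]
      intro hx
      rw [hx]
      exact hi'
    rw [this, Finset.sum_congr rfl (g := fun _ => h (i, o)), Finset.sum_const, nsmul_eq_mul]
    intro x hx
    rw [(Finset.mem_filter.1 hx).2]
  rw [Finset.sum_congr rfl fun o _ => h2 o, Fintype.sum_option, hlab.card_none i hi',
    Finset.mul_sum]
  congr 1
  exact Finset.sum_congr rfl fun b _ => by rw [hlab.card_some i hi' b]

/-- The valuation of a buyer with the set `C` of admissible labels: the maximum of the components
of both parities over all labels in `C`. -/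
noncomputable def valuation {n : ℕ} (lab : Fin n → ℕ × Option (Fin g)) (C : Finset (Fin g))
    (hC : C.Nonempty) : Valuation (Fin n) :=
  maxAdditive ((Finset.univ : Finset (Fin 2)) ×ˢ C) (Finset.univ_nonempty.product hC)
    fun k x => D.value k.1 k.2 (lab x)

theorem isMaxOfAdditive_valuation {n : ℕ} (lab : Fin n → ℕ × Option (Fin g)) (C : Finset (Fin g))
    (hC : C.Nonempty) : IsMaxOfAdditive (2 * C.card) (D.valuation lab C hC) := by
  have h := isMaxOfAdditive_maxAdditive
    ((Finset.univ_nonempty (α := Fin 2)).product hC)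
    (fun (k : Fin 2 × Fin g) x => D.value k.1 k.2 (lab x)) fun k x => D.value_nonneg _ _ _
  rw [Finset.card_product, Finset.card_univ, Fintype.card_fin] at h
  exact h

/-! ### The components chosen by the buyers -/

/-- However the buyers choose admissible labels, each buyer has an admissible label that none of
the earlier buyers has chosen. -/
def HasFreshLabels (C : Fin g → Finset (Fin g)) : Prop :=
  ∀ (σ : Equiv.Perm (Fin g)) (c : Fin g → Fin g), (∀ k, c k ∈ C (σ k)) →
    ∀ k, ∃ b ∈ C (σ k), ∀ k' < k, c k' ≠ b

/-- `f k` is the component (parity and label) by which the `k`-th buyer in the order `σ` values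
the bundle she buys. -/
structure IsChoice {n : ℕ} (lab : Fin n → ℕ × Option (Fin g)) (C : Fin g → Finset (Fin g))
    (p : ℝ) (σ : Equiv.Perm (Fin g)) (B : Fin g → Finset (Fin n))
    (f : Fin g → Fin 2 × Fin g) : Prop where
  subset : ∀ k, B (σ k) ⊆ unsold σ B k
  label_mem : ∀ k, (f k).2 ∈ C (σ k)
  le_value : ∀ k, ∀ x ∈ B (σ k), p ≤ D.value (f k).1 (f k).2 (lab x)
  mem_of_lt : ∀ k, ∀ x ∈ unsold σ B k, p < D.value (f k).1 (f k).2 (lab x) → x ∈ B (σ k)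
  sum_le : ∀ k, ∀ s : Fin 2, ∀ b ∈ C (σ k), ∀ T ⊆ unsold σ B k,
    ∑ x ∈ T, (D.value s b (lab x) - p) ≤
      ∑ x ∈ B (σ k), (D.value (f k).1 (f k).2 (lab x) - p)

theorem exists_isChoice {n : ℕ} {lab : Fin n → ℕ × Option (Fin g)} {C : Fin g → Finset (Fin g)}
    {hC : ∀ b, (C b).Nonempty} {p : ℝ} {σ : Equiv.Perm (Fin g)} {B : Fin g → Finset (Fin n)}
    (h : IsOutcome (fun b => D.valuation lab (C b) (hC b)) (fun _ => p) σ B) :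
    ∃ f, D.IsChoice lab C p σ B f := by
  choose f hf1 hf2 hf3 hf4 using fun k => (h k).exists_component
  exact ⟨f, fun k => (h k).1, fun k => (Finset.mem_product.1 (hf1 k)).2, hf2, hf3,
    fun k s b hb T hT => hf4 k (s, b) (Finset.mem_product.2 ⟨Finset.mem_univ _, hb⟩) T hT⟩

variable {D} {n : ℕ} {lab : Fin n → ℕ × Option (Fin g)} {C : Fin g → Finset (Fin g)} {p : ℝ}
  {σ : Equiv.Perm (Fin g)} {B : Fin g → Finset (Fin n)} {f : Fin g → Fin 2 × Fin g}

theorem sum_label_eq (hlab : D.IsLabelling lab) {i : ℕ} (hi : i ≤ K) (b : Fin g)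
    {h : Fin n → ℝ} {y : ℝ} (hy : ∀ x, lab x = (i, some b) → h x = y) :
    ∑ x ∈ Finset.univ.filter (fun x => lab x = (i, some b)), h x = D.N i * y := by
  rw [Finset.sum_congr rfl (g := fun _ => y) fun x hx => hy x (Finset.mem_filter.1 hx).2,
    Finset.sum_const, hlab.card_some i hi, nsmul_eq_mul]

theorem sum_unlabelled_eq (hlab : D.IsLabelling lab) {i : ℕ} (hi : i ≤ K)
    {h : Fin n → ℝ} {y : ℝ} (hy : ∀ x, lab x = (i, none) → h x = y) :
    ∑ x ∈ Finset.univ.filter (fun x => lab x = (i, none)), h x = D.M i * y := by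
  rw [Finset.sum_congr rfl (g := fun _ => y) fun x hx => hy x (Finset.mem_filter.1 hx).2,
    Finset.sum_const, hlab.card_none i hi, nsmul_eq_mul]

theorem IsLabelling.sum_le (hlab : D.IsLabelling lab) {S : Finset (Fin n)} {t : Fin n → ℝ}
    (h : ℕ × Option (Fin g) → ℝ) (h0 : ∀ l, K < l.1 → h l = 0) (hn : ∀ l, 0 ≤ h l)
    (ht : ∀ x ∈ S, t x ≤ h (lab x)) :
    ∑ x ∈ S, t x ≤ ∑ i ∈ Finset.range (K + 1),
      ((D.M i : ℝ) * h (i, none) + D.N i * ∑ b, h (i, some b)) := by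
  rw [← hlab.sum_eq h h0]
  exact (Finset.sum_le_sum ht).trans
    (Finset.sum_le_sum_of_subset_of_nonneg (Finset.subset_univ _) fun x _ _ => hn _)

theorem value_label_of_even {s i : ℕ} (h : (i + s) % 2 = 0) (b c : Fin g) :
    D.value s c (i, some b) = if b = c then D.r i else 0 := by simp [value, h]

theorem value_label_of_odd {s i : ℕ} (h : (i + s) % 2 = 1) (b c : Fin g) :
    D.value s c (i, some b) = D.w i := by simp [value, h]

theorem value_unlabelled_of_odd {s i : ℕ} (h : (i + s) % 2 = 1) (c : Fin g) :
    D.value s c (i, none) = 2 * D.w i := by simp [value, h]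

theorem value_unlabelled_of_even {s i : ℕ} (h : (i + s) % 2 = 0) (c : Fin g) :
    D.value s c (i, none) = D.w i := by simp [value, h]

theorem w_le_value_unlabelled (s i : ℕ) (c : Fin g) : D.w i ≤ D.value s c (i, none) := by
  have := D.w_nonneg i
  simp only [value]
  split_ifs <;> linarith

theorem value_unlabelled_le (s i : ℕ) (c : Fin g) : D.value s c (i, none) ≤ 2 * D.w i := by
  have := D.w_nonneg i
  simp only [value]
  split_ifs <;> linarith

theorem value_label_le (s i : ℕ) (b c : Fin g) :
    D.value s c (i, some b) ≤ D.w i + if b = c then D.r i else 0 := by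
  have := D.w_nonneg i
  have := D.r_nonneg i
  simp only [value]
  split_ifs <;> linarith

theorem value_eq_zero (s : ℕ) (c : Fin g) {l : ℕ × Option (Fin g)} (h : K < l.1) :
    D.value s c l = 0 := by
  rcases l with ⟨i, _ | b⟩ <;> simp [value, D.r_eq_zero i h, D.w_eq_zero i h]

theorem IsChoice.level_le (hf : D.IsChoice lab C p σ B f) (hp : 0 < p) {k : Fin g} {x : Fin n}
    (hx : x ∈ B (σ k)) : (lab x).1 ≤ K := by
  by_contra! h
  have := hf.le_value k x hx
  rw [D.value_eq_zero _ _ h] at this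
  linarith

/-- The first buyer prefers the components which value the unlabelled items of level `j + 1`
twice as high. -/
theorem IsChoice.parity_of_first (hlab : D.IsLabelling lab) (hf : D.IsChoice lab C p σ B f)
    {j : ℕ} (hj : j + 2 ≤ K) (hp : 0 < p) (hp1 : 2 * D.w j < p) (hp2 : 2 * p < D.w (j + 1))
    {k : Fin g} (hk : ∀ k', ¬ k' < k) : (((f k).1 : ℕ) + j) % 2 = 0 := by
  by_contra hpar
  have hodd : (((f k).1 : ℕ) + j) % 2 = 1 := by omega
  obtain ⟨s, hs⟩ : ∃ s : Fin 2, (j + 1 + (s : ℕ)) % 2 = 1 := by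
    rcases Nat.mod_two_eq_zero_or_one j with h | h
    · exact ⟨0, by simp; omega⟩
    · exact ⟨1, by simp; omega⟩
  have hlow := hf.sum_le k s _ (hf.label_mem k)
    (Finset.univ.filter fun x => lab x = (j + 1, none))
    (fun x _ => mem_unsold.2 fun k' hk' => absurd hk' (hk k'))
  rw [sum_unlabelled_eq hlab (by omega) (y := 2 * D.w (j + 1) - p)
    (fun x hx => by rw [hx, value_unlabelled_of_odd hs])] at hlow
  set c := (f k).2
  have hup := hlab.sum_le (S := B (σ k)) (t := fun x => D.value (f k).1 c (lab x) - p)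
    (fun l => match l with
      | (i, none) => (if i ≤ j + 1 then 0 else 2 * D.w i) + if i = j + 1 then D.w i else 0
      | (i, some b) => D.w i + if b = c then D.r i else 0)
    (by
      rintro ⟨i, _ | b⟩ hi
      · simp [D.w_eq_zero i hi]
      · simp [D.w_eq_zero i hi, D.r_eq_zero i hi])
    (by
      rintro ⟨i, _ | b⟩ <;> have := D.w_nonneg i <;> have := D.r_nonneg i <;> dsimp only <;>
        split_ifs <;> linarith)
    (by
      intro x hx
      have hpx := hf.le_value k x hx
      have hKx := hf.level_le hp hx
      generalize lab x = l at hpx hKx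
      obtain ⟨i, _ | b⟩ := l
      · dsimp only at hKx ⊢
        have h1 := value_unlabelled_le (D := D) (f k).1 i c
        rcases lt_trichotomy i (j + 1) with h | h | h
        · have := D.w_mono i j (by omega) (by omega)
          linarith
        · subst h
          rw [value_unlabelled_of_even (by omega)]
          simp
          exact hp.le
        · rw [if_neg (by omega), if_neg (by omega)]
          linarith
      · dsimp only
        have h1 := value_label_le (D := D) (f k).1 i b c
        linarith)
  have hsum : ∑ i ∈ Finset.range (K + 1),
      ((D.M i : ℝ) * ((if i ≤ j + 1 then 0 else 2 * D.w i) + if i = j + 1 then D.w i else 0) +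
        D.N i * ∑ b, (D.w i + if b = c then D.r i else 0)) =
      ∑ i ∈ Finset.range (K + 1), (D.N i : ℝ) * (g * D.w i + D.r i) +
      ∑ i ∈ Finset.range (K + 1), (D.M i : ℝ) * (if i ≤ j + 1 then 0 else 2 * D.w i) +
      D.M (j + 1) * D.w (j + 1) := by
    have h1 : (D.M (j + 1) : ℝ) * D.w (j + 1) =
        ∑ i ∈ Finset.range (K + 1), (D.M i : ℝ) * (if i = j + 1 then D.w i else 0) := by
      simp only [mul_ite, mul_zero]
      rw [Finset.sum_ite_eq' (Finset.range (K + 1)) (j + 1) (fun i => (D.M i : ℝ) * D.w i),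
        if_pos (by simp; omega)]
    rw [h1, ← Finset.sum_add_distrib, ← Finset.sum_add_distrib]
    refine Finset.sum_congr rfl fun i _ => ?_
    simp only [Finset.sum_add_distrib, Finset.sum_const, Finset.card_univ, Fintype.card_fin,
      nsmul_eq_mul, Finset.sum_ite_eq', Finset.mem_univ, if_true]
    ring
  dsimp only at hup
  rw [hsum] at hup
  have h1 := D.first_lt j hj
  have hM : (0 : ℝ) < D.M (j + 1) := by exact_mod_cast D.M_pos (j + 1) (by omega)
  nlinarith

/-- When the first buyer has taken all items of the higher levels which her component values by
`w`, a component of the other parity offers to a later buyer hardly more than her own items of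
level `j`, and this is less than the value of the own items with a fresh label of the levels
`j + 1` and `j + 3`. -/
theorem IsChoice.parity_of_later (hlab : D.IsLabelling lab) (hf : D.IsChoice lab C p σ B f)
    (hC : HasFreshLabels C)
    {j : ℕ} (hj : j + 3 ≤ K) (hp : 0 < p) (hp1 : 2 * D.w (j + 1) < p)
    (hp2 : 2 * p < D.w (j + 2)) {k₀ k : Fin g} (hk₀ : ∀ k', ¬ k' < k₀) (hk : k₀ < k)
    (ih : ∀ k' < k, (((f k').1 : ℕ) + (j + 1)) % 2 = 0) :
    (((f k).1 : ℕ) + (j + 1)) % 2 = 0 := by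
  by_contra hpar
  have hodd : (((f k).1 : ℕ) + (j + 1)) % 2 = 1 := by omega
  obtain ⟨s, hs⟩ : ∃ s : Fin 2, (j + 1 + (s : ℕ)) % 2 = 0 := by
    rcases Nat.mod_two_eq_zero_or_one j with h | h
    · exact ⟨1, by simp; omega⟩
    · exact ⟨0, by simp; omega⟩
  -- The items which the first buyer values above the price are no longer on offer.
  have hgone : ∀ x ∈ B (σ k), D.value (f k₀).1 (f k₀).2 (lab x) ≤ p := by
    intro x hx
    by_contra! hlt
    by_cases hx0 : x ∈ unsold σ B k₀
    · have hx1 := hf.mem_of_lt k₀ x hx0 hlt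
      exact mem_unsold.1 (hf.subset k hx) k₀ hk hx1
    · exact hx0 (mem_unsold.2 fun k' hk' => absurd hk' (hk₀ k'))
  have h0 := ih k₀ hk
  obtain ⟨b, hbC, hb⟩ := hC σ (fun k => (f k).2) hf.label_mem k
  have hown : ∀ i, (i + (j + 1)) % 2 = 0 → ∀ x, lab x = (i, some b) → x ∈ unsold σ B k := by
    intro i hi x hx
    refine mem_unsold.2 fun k' hk' hxB => ?_
    have h1 := hf.le_value k' x hxB
    have h2 := ih k' hk'
    rw [hx, value_label_of_even (by omega), if_neg (Ne.symm (hb k' hk'))] at h1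
    linarith
  have hlow := hf.sum_le k s b hbC
    ((Finset.univ.filter fun x => lab x = (j + 1, some b)) ∪
      Finset.univ.filter fun x => lab x = (j + 3, some b))
    (by
      intro x hx
      simp only [Finset.mem_union, Finset.mem_filter, Finset.mem_univ, true_and] at hx
      rcases hx with hx | hx
      · exact hown _ (by omega) x hx
      · exact hown _ (by omega) x hx)
  rw [Finset.sum_union (by
      rw [Finset.disjoint_filter]
      intro x _ h1 h2
      simp [h1] at h2),
    sum_label_eq hlab (by omega) b (y := D.r (j + 1) - p)
      (fun x hx => by rw [hx, value_label_of_even (by omega), if_pos rfl]),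
    sum_label_eq hlab (by omega) b (y := D.r (j + 3) - p)
      (fun x hx => by rw [hx, value_label_of_even (by omega), if_pos rfl])] at hlow
  set c := (f k).2
  have hup := hlab.sum_le (S := B (σ k)) (t := fun x => D.value (f k).1 c (lab x) - p)
    (fun l => match l with
      | (_, none) => 0
      | (i, some b) => D.w i + if b = c then (if i = j then D.r i else 0) else 0)
    (by
      rintro ⟨i, _ | b⟩ hi
      · rfl
      · simp [D.w_eq_zero i hi, D.r_eq_zero i hi])
    (by
      rintro ⟨i, _ | b⟩
      · exact le_rfl
      · have := D.w_nonneg i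
        have := D.r_nonneg i
        dsimp only
        split_ifs <;> linarith)
    (by
      intro x hx
      have hpx := hf.le_value k x hx
      have hKx := hf.level_le hp hx
      have hgx := hgone x hx
      generalize lab x = l at hpx hKx hgx
      obtain ⟨i, _ | b⟩ := l
      · dsimp only at hKx ⊢
        have h1 := value_unlabelled_le (D := D) (f k).1 i c
        have h2 := w_le_value_unlabelled (D := D) (f k₀).1 i (f k₀).2
        rcases le_or_gt i (j + 1) with h | h
        · have := D.w_mono i (j + 1) h (by omega)
          linarith
        · have := D.w_mono (j + 2) i h hKx
          linarith
      · dsimp only at hKx ⊢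
        have hw := D.w_nonneg i
        rcases Nat.mod_two_eq_zero_or_one (i + (f k).1) with hi | hi
        · rw [value_label_of_even hi] at hpx ⊢
          by_cases hbc : b = c
          · rw [if_pos hbc] at hpx ⊢
            rw [if_pos hbc]
            rcases lt_trichotomy i j with h | h | h
            · have := D.dead i (j + 1) (by omega) (by omega)
              have := D.w_pos (j + 1) (by omega)
              linarith
            · rw [if_pos h]
              linarith
            · rw [value_label_of_odd (by omega)] at hgx
              have := D.w_mono (j + 2) i (by omega) hKx
              linarith
          · rw [if_neg hbc] at hpx ⊢
            linarith
        · rw [value_label_of_odd hi]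
          have : 0 ≤ if b = c then (if i = j then D.r i else 0) else 0 := by
            have := D.r_nonneg i
            split_ifs <;> linarith
          linarith)
  have hsum : ∑ i ∈ Finset.range (K + 1), ((D.M i : ℝ) * 0 + D.N i *
        ∑ b, (D.w i + if b = c then (if i = j then D.r i else 0) else 0)) =
      D.N j * D.r j + ∑ i ∈ Finset.range (K + 1), (D.N i : ℝ) * (g * D.w i) := by
    have h1 : (D.N j : ℝ) * D.r j =
        ∑ i ∈ Finset.range (K + 1), (D.N i : ℝ) * (if i = j then D.r i else 0) := by
      simp only [mul_ite, mul_zero]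
      rw [Finset.sum_ite_eq' (Finset.range (K + 1)) j (fun i => (D.N i : ℝ) * D.r i),
        if_pos (by simp; omega)]
    rw [h1, ← Finset.sum_add_distrib]
    refine Finset.sum_congr rfl fun i _ => ?_
    simp only [Finset.sum_add_distrib, Finset.sum_const, Finset.card_univ, Fintype.card_fin,
      nsmul_eq_mul, Finset.sum_ite_eq', Finset.mem_univ, if_true]
    ring
  dsimp only at hup
  rw [hsum] at hup
  have h1 := D.later_lt j hj
  have h2 := D.cheap (j + 1) (j + 2) (by omega) (by omega) (by omega)
  have h3 := D.cheap (j + 3) (j + 2) (by omega) (by omega) (by omega)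
  have h4 : p * D.N (j + 1) ≤ D.w (j + 2) / 2 * D.N (j + 1) :=
    mul_le_mul_of_nonneg_right (by linarith) (Nat.cast_nonneg _)
  have h5 : p * D.N (j + 3) ≤ D.w (j + 2) / 2 * D.N (j + 3) :=
    mul_le_mul_of_nonneg_right (by linarith) (Nat.cast_nonneg _)
  linarith

/-- At a price between `2 * D.w (j + 1)` and `D.w (j + 2) / 2` all buyers choose the parity of
`j + 1`. -/
theorem IsChoice.parity (hlab : D.IsLabelling lab) (hf : D.IsChoice lab C p σ B f)
    (hC : HasFreshLabels C)
    {j : ℕ} (hj : j + 3 ≤ K) (hp : 0 < p) (hp1 : 2 * D.w (j + 1) < p)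
    (hp2 : 2 * p < D.w (j + 2)) (k : Fin g) : (((f k).1 : ℕ) + (j + 1)) % 2 = 0 := by
  have hg : 0 < g := k.pos
  have hk₀ : ∀ k' : Fin g, ¬ k' < ⟨0, hg⟩ := fun k' h => absurd (Fin.lt_def.1 h) (by simp)
  induction k using WellFoundedLT.induction with
  | ind k ih =>
    rcases Nat.eq_zero_or_pos (k : ℕ) with h | h
    · exact hf.parity_of_first hlab (by omega) hp hp1 hp2 (by
        intro k' hk'
        have := Fin.lt_def.1 hk'
        omega)
    · exact hf.parity_of_later hlab hC hj hp hp1 hp2 hk₀ (Fin.lt_def.2 h) ih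

/-- At each price there is a level `j₀` such that nobody buys own items of lower levels, and on
the other levels the own items that are bought by a single buyer are cheap. -/
theorem IsChoice.exists_level (hK : 2 ≤ K) (hlab : D.IsLabelling lab)
    (hf : D.IsChoice lab C p σ B f) (hC : HasFreshLabels C) (hp : 0 < p) :
    ∃ j₀, (∀ k, ∀ x ∈ B (σ k), ∀ i, lab x = (i, some (f k).2) → (i + ((f k).1 : ℕ)) % 2 = 0 →
        j₀ ≤ i ∧ p ≤ D.r i) ∧
      ∀ i ≤ K, j₀ ≤ i → p ≤ D.r i → D.N i * p ≤ D.ρ := by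
  have hle : ∀ k, ∀ x ∈ B (σ k), ∀ i, lab x = (i, some (f k).2) →
      (i + ((f k).1 : ℕ)) % 2 = 0 → p ≤ D.r i := by
    intro k x hx i hi hpar
    have := hf.le_value k x hx
    rwa [hi, value_label_of_even hpar, if_pos rfl] at this
  have hdead : ∀ j, j ≤ K → D.w j ≤ 2 * p → ∀ i, p ≤ D.r i → j ≤ i + 1 := by
    intro j hj hjp i hi
    by_contra! h
    have := D.dead i j h hj
    linarith
  have hcheap : ∀ i j, j ≤ i + 1 → i ≤ K → j ≤ K → p ≤ 2 * D.w j → D.N i * p ≤ D.ρ := by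
    intro i j hij hi hj hpj
    have h1 := D.cheap i j hij hi hj
    have h2 : (D.N i : ℝ) * p ≤ D.N i * (2 * D.w j) :=
      mul_le_mul_of_nonneg_left hpj (Nat.cast_nonneg _)
    have := D.two_delta_le
    linarith
  by_cases h : ∃ j, j + 2 ≤ K ∧ 2 * p < D.w (j + 1)
  · classical
    obtain ⟨hj, hjp⟩ := Nat.find_spec h
    have hmin := fun m => Nat.find_min h (m := m)
    generalize Nat.find h = j at hj hjp hmin
    rcases j with _ | j
    · exact ⟨0, fun k x hx i hi hpar => ⟨Nat.zero_le _, hle k x hx i hi hpar⟩,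
        fun i hi _ _ => hcheap i 1 (by omega) hi (by omega) (by linarith)⟩
    · have hjp' : D.w (j + 1) ≤ 2 * p := by
        by_contra! hlt
        exact hmin j (by omega) ⟨by omega, hlt⟩
      rcases le_or_gt p (2 * D.w (j + 1)) with h2 | h2
      · exact ⟨j, fun k x hx i hi hpar => ⟨by
            have := hdead (j + 1) (by omega) hjp' i (hle k x hx i hi hpar)
            omega, hle k x hx i hi hpar⟩,
          fun i hi hji _ => hcheap i (j + 1) (by omega) hi (by omega) h2⟩
      · refine ⟨j + 1, fun k x hx i hi hpar => ⟨?_, hle k x hx i hi hpar⟩,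
          fun i hi hji _ => hcheap i (j + 2) (by omega) hi (by omega) (by linarith)⟩
        have h3 := hdead (j + 1) (by omega) hjp' i (hle k x hx i hi hpar)
        have h4 := hf.parity hlab hC (by omega) hp h2 hjp k
        omega
  · push Not at h
    obtain ⟨K', rfl⟩ : ∃ K', K = K' + 2 := ⟨K - 2, by omega⟩
    refine ⟨K', fun k x hx i hi hpar => ⟨?_, hle k x hx i hi hpar⟩, fun i hi hKi hpi => ?_⟩
    · have := hdead (K' + 1) (by omega) (h K' le_rfl) i (hle k x hx i hi hpar)
      omega
    · have h1 := D.top_le i hi (by omega)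
      have h2 : (D.N i : ℝ) * p ≤ D.N i * D.r i :=
        mul_le_mul_of_nonneg_left hpi (Nat.cast_nonneg _)
      linarith

/-! ### Revenue and welfare -/

/-- The items valued by `w` contribute at most their total value to the revenue, and the own items
of each buyer contribute at most `ρ` per level. -/
theorem revenue_le (hK : 2 ≤ K) (hlab : D.IsLabelling lab) {hCne : ∀ b, (C b).Nonempty}
    (hC : HasFreshLabels C) (hp : 0 ≤ p)
    (h : IsOutcome (fun b => D.valuation lab (C b) (hCne b)) (fun _ => p) σ B) :
    revenue (fun _ => p) B ≤
      ∑ i ∈ Finset.range (K + 1), 2 * D.w i * (D.M i + g * D.N i) + g * ((K + 1) * D.ρ) := by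
  classical
  have hnn : 0 ≤ ∑ i ∈ Finset.range (K + 1), 2 * D.w i * (D.M i + g * D.N i) :=
    Finset.sum_nonneg fun i _ => by have := D.w_nonneg i; positivity
  have hρ := D.rho_nonneg
  rcases hp.eq_or_lt with rfl | hp
  · simp only [revenue, Finset.sum_const_zero]
    positivity
  obtain ⟨f, hf⟩ := exists_isChoice D h
  obtain ⟨j₀, hj, hj'⟩ := hf.exists_level hK hlab hC hp
  set own : Fin g → ℕ × Option (Fin g) → ℝ := fun c l => match l with
    | (_, none) => 0
    | (i, some b) => if b = c then (if j₀ ≤ i ∧ i ≤ K ∧ p ≤ D.r i then p else 0) else 0 with hown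
  have hpt : ∀ k, ∀ x ∈ B (σ k), p ≤ 2 * D.w (lab x).1 + own (f k).2 (lab x) := by
    intro k x hx
    have hpx := hf.le_value k x hx
    have hKx := hf.level_le hp hx
    have hjx := hj k x hx
    generalize lab x = l at hpx hKx hjx
    obtain ⟨i, _ | b⟩ := l
    · have := value_unlabelled_le (D := D) (f k).1 i (f k).2
      simp only [hown]
      linarith
    · have hw := D.w_nonneg i
      simp only [hown]
      rcases Nat.mod_two_eq_zero_or_one (i + (f k).1) with hi | hi
      · rw [value_label_of_even hi] at hpx
        by_cases hb : b = (f k).2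
        · subst hb
          have := hjx i rfl hi
          rw [if_pos rfl, if_pos ⟨this.1, hKx, this.2⟩]
          linarith
        · rw [if_neg hb] at hpx
          linarith
      · rw [value_label_of_odd hi] at hpx
        have : 0 ≤ if b = (f k).2 then
            (if j₀ ≤ i ∧ i ≤ K ∧ p ≤ D.r i then p else 0) else (0 : ℝ) := by
          split_ifs <;> linarith
        linarith
  have hrev : revenue (fun _ => p) B = ∑ k, ∑ x ∈ B (σ k), p :=
    (Equiv.sum_comp σ fun b => ∑ x ∈ B b, p).symm
  have hw : ∑ k, ∑ x ∈ B (σ k), 2 * D.w (lab x).1 ≤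
      ∑ i ∈ Finset.range (K + 1), 2 * D.w i * (D.M i + g * D.N i) := by
    rw [← Finset.sum_biUnion (fun k _ l _ hkl => h.pairwiseDisjoint hkl)]
    refine (hlab.sum_le (fun l => 2 * D.w l.1) (fun l hl => by simp [D.w_eq_zero _ hl])
      (fun l => by have := D.w_nonneg l.1; positivity) fun x _ => le_rfl).trans_eq ?_
    refine Finset.sum_congr rfl fun i _ => ?_
    simp only [Finset.sum_const, Finset.card_univ, Fintype.card_fin, nsmul_eq_mul]
    ring
  have hr : ∀ k, ∑ x ∈ B (σ k), own (f k).2 (lab x) ≤ (K + 1) * D.ρ := by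
    intro k
    refine (hlab.sum_le (own (f k).2) ?_ ?_ fun x _ => le_rfl).trans ?_
    · rintro ⟨i, _ | b⟩ hi
      · rfl
      · have : ¬ i ≤ K := not_le.2 hi
        simp [hown, this]
    · rintro ⟨i, _ | b⟩
      · exact le_rfl
      · simp only [hown]
        split_ifs <;> linarith
    · refine (Finset.sum_le_card_nsmul _ _ D.ρ fun i hi => ?_).trans_eq (by simp)
      have hi' : i ≤ K := by simpa [Nat.lt_succ_iff] using hi
      simp only [hown, mul_zero, zero_add, Finset.sum_ite_eq', Finset.mem_univ, if_true]
      split_ifs with hc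
      · exact hj' i hi' hc.1 hc.2.2
      · simpa using hρ
  rw [hrev]
  calc ∑ k, ∑ x ∈ B (σ k), p
      ≤ ∑ k, ∑ x ∈ B (σ k), (2 * D.w (lab x).1 + own (f k).2 (lab x)) :=
        Finset.sum_le_sum fun k _ => Finset.sum_le_sum fun x hx => hpt k x hx
    _ = ∑ k, ∑ x ∈ B (σ k), 2 * D.w (lab x).1 + ∑ k, ∑ x ∈ B (σ k), own (f k).2 (lab x) := by
        simp only [Finset.sum_add_distrib]
    _ ≤ _ := by
        refine add_le_add hw ((Finset.sum_le_card_nsmul _ _ _ fun k _ => hr k).trans_eq ?_)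
        simp

/-- Every buyer can receive her own items of level `0`. -/
theorem le_opt (hlab : D.IsLabelling lab) {hCne : ∀ b, (C b).Nonempty} (hC : ∀ b, b ∈ C b) :
    g * (D.N 0 * D.r 0) ≤ opt fun b => D.valuation lab (C b) (hCne b) := by
  classical
  refine le_trans ?_ ((isGreatest_opt _).2
    ⟨fun b => Finset.univ.filter fun x => lab x = (0, some b), ?_, rfl⟩)
  · have : ∀ b, D.N 0 * D.r 0 ≤ D.valuation lab (C b) (hCne b)
        (Finset.univ.filter fun x => lab x = (0, some b)) := by
      intro b
      refine le_trans (le_of_eq ?_) (sum_le_maxAdditive _ _ (k := ((0 : Fin 2), b))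
        (Finset.mem_product.2 ⟨Finset.mem_univ _, hC b⟩) _)
      exact (sum_label_eq hlab (Nat.zero_le _) b
        fun x hx => by rw [hx, value_label_of_even (by simp), if_pos rfl]).symm
    refine le_trans (le_of_eq ?_) (Finset.sum_le_sum fun b _ => this b)
    simp
  · intro b b' hbb'
    rw [Finset.disjoint_filter]
    intro x _ h1 h2
    rw [h1] at h2
    exact hbb' (by simpa using h2)

theorem hasFreshLabels_singleton : HasFreshLabels (fun b : Fin g => ({b} : Finset (Fin g))) := by
  intro σ c hc k
  refine ⟨σ k, by simp, fun k' hk' h => ?_⟩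
  have := hc k'
  simp only [Finset.mem_singleton] at this
  exact hk'.ne (σ.injective (this.symm.trans h))

theorem hasFreshLabels_univ : HasFreshLabels (fun _ : Fin g => (Finset.univ : Finset (Fin g))) := by
  classical
  intro σ c _ k
  by_contra! h
  have h1 : (Finset.univ : Finset (Fin g)) ⊆ (Finset.Iio k).image c := by
    intro b hb
    obtain ⟨k', hk', rfl⟩ := h b hb
    exact Finset.mem_image_of_mem _ (Finset.mem_Iio.2 hk')
  have h2 := (Finset.card_le_card h1).trans Finset.card_image_le
  simp at h2
  have := k.2
  omega

end LevelScheme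

/-! ### A scheme with `2 ^ O(K ^ 2)` items -/

theorem sum_three_quarters_pow_le (n : ℕ) : ∑ i ∈ Finset.range n, (3 / 4 : ℝ) ^ i ≤ 4 := by
  rw [geom_sum_eq (by norm_num), div_le_iff_of_neg (by norm_num)]
  have : (0 : ℝ) ≤ (3 / 4) ^ n := by positivity
  linarith

theorem sum_sixteen_pow_le {K m : ℕ} (hm : m ≤ K) :
    ∑ i ∈ Finset.range (K + 1), (if i ≤ m then (0 : ℝ) else 40 * 16 ^ (K - i)) ≤
      8 / 3 * 16 ^ (K - m) := by
  have key : ∀ t, m ≤ t → t ≤ K →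
      ∑ i ∈ Finset.range (t + 1), (if i ≤ m then (0 : ℝ) else 40 * 16 ^ (K - i)) =
        8 / 3 * (16 ^ (K - m) - 16 ^ (K - t)) := by
    intro t ht
    induction t, ht using Nat.le_induction with
    | base =>
      intro _
      rw [sub_self, mul_zero]
      exact Finset.sum_eq_zero fun i hi => if_pos (by simpa [Nat.lt_succ_iff] using hi)
    | succ t ht ih =>
      intro h
      rw [Finset.sum_range_succ, ih (by omega), if_neg (by omega),
        show K - t = (K - (t + 1)) + 1 by omega, pow_succ]
      ring
  rw [key K hm le_rfl]
  have : (0 : ℝ) < 16 ^ (K - K) := by positivity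
  linarith

theorem six_mul_lt_three_pow {K : ℕ} (hK : 4 ≤ K) : 6 * (K + 2) < 3 ^ K := by
  induction K, hK using Nat.le_induction with
  | base => norm_num
  | succ K _ ih => rw [pow_succ]; omega

namespace LevelScheme

/-- The number of items per label on level `i` in the geometric scheme; it drops by the square of
`16 ^ K` from each level to the next. -/
def geomN (K i : ℕ) : ℕ := (16 ^ K) ^ (2 * (K - i))

theorem geomN_pos (K i : ℕ) : 0 < geomN K i := by unfold geomN; positivity

theorem geomN_le {K i j e : ℕ} (h : 2 * (K - i) ≤ e + 2 * (K - j)) :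
    geomN K i ≤ (16 ^ K) ^ e * geomN K j := by
  unfold geomN
  rw [← pow_add]
  exact Nat.pow_le_pow_right (by positivity) h

theorem le_geomN {K i j e : ℕ} (h : e + 2 * (K - j) ≤ 2 * (K - i)) :
    (16 ^ K) ^ e * geomN K j ≤ geomN K i := by
  unfold geomN
  rw [← pow_add]
  exact Nat.pow_le_pow_right (by positivity) h

theorem geom_mul_w {K i : ℕ} (hi : i ≤ K) :
    (geomN K i : ℝ) * (((16 ^ K) ^ 3 : ℕ) * (if i ≤ K then
      1 / (4 ^ K * (16 ^ K) ^ 3 * (geomN K i : ℝ)) else 0)) = 1 / 4 ^ K := by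
  have : (geomN K i : ℝ) ≠ 0 := by exact_mod_cast (geomN_pos K i).ne'
  rw [if_pos hi]
  push_cast
  field_simp

/-- The scheme with geometrically growing values. The own items of a label on level `i` are
together worth `(3 / 4) ^ i`, the labelled items of a level are together worth `4 ^ (-K)` to a
component of the other parity, and the unlabelled ones are worth `20 * 16 ^ (K - i)` to a component
of the same parity. The ratio `3 / 4` satisfies `1 < 3 / 4 + (3 / 4) ^ 3`, as needed for
`later_lt`. -/
noncomputable def geom (K : ℕ) (hK : 4 ≤ K) : LevelScheme K ((16 ^ K) ^ 3) where
  N := geomN K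
  M i := 20 * 16 ^ (K - i) * 4 ^ K * (16 ^ K) ^ 3 * geomN K i
  r i := if i ≤ K then (3 / 4) ^ i / geomN K i else 0
  w i := if i ≤ K then 1 / (4 ^ K * (16 ^ K) ^ 3 * geomN K i) else 0
  δ := 1 / (4 ^ K * 16 ^ K)
  ρ := 2 * (3 / 4) ^ K
  r_nonneg i := by split_ifs <;> positivity
  w_nonneg i := by split_ifs <;> positivity
  r_eq_zero i hi := if_neg (by omega)
  w_eq_zero i hi := if_neg (by omega)
  w_mono i j hij hj := by
    have h1 : geomN K j ≤ geomN K i := by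
      simpa using geomN_le (K := K) (i := j) (j := i) (e := 0) (by omega)
    have h2 : (0 : ℝ) < geomN K j := by exact_mod_cast geomN_pos K j
    have h3 : (geomN K j : ℝ) ≤ geomN K i := by exact_mod_cast h1
    rw [if_pos (by omega), if_pos hj]
    gcongr
  w_pos i hi := by
    have : (0 : ℝ) < geomN K i := by exact_mod_cast geomN_pos K i
    rw [if_pos hi]
    positivity
  dead i j hij hj := by
    have h2 : (0 : ℝ) < geomN K j := by exact_mod_cast geomN_pos K j
    have h3 : (16 ^ K : ℝ) ^ 4 * geomN K j ≤ geomN K i := by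
      exact_mod_cast le_geomN (K := K) (i := i) (j := j) (e := 4) (by omega)
    have h4 : ((3 : ℝ) / 4) ^ i ≤ 1 := pow_le_one₀ (by norm_num) (by norm_num)
    have h5 : (2 : ℝ) < 4 ^ K := by
      calc (2 : ℝ) < 4 ^ 4 := by norm_num
        _ ≤ 4 ^ K := pow_le_pow_right₀ (by norm_num) hK
    have h6 : (16 : ℝ) ^ K = 4 ^ K * 4 ^ K := by rw [← mul_pow]; norm_num
    rw [if_pos (by omega), if_pos hj]
    calc 2 * ((3 / 4 : ℝ) ^ i / geomN K i) ≤ 2 * (1 / ((16 ^ K) ^ 4 * geomN K j)) := by gcongr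
      _ < 4 ^ K * (1 / ((16 ^ K) ^ 4 * geomN K j)) := by gcongr
      _ = 1 / (4 ^ K * (16 ^ K) ^ 3 * geomN K j) := by
        rw [pow_succ _ 3]
        nth_rewrite 2 [h6]
        field_simp
  cheap i j hij hi hj := by
    have h2 : (0 : ℝ) < geomN K j := by exact_mod_cast geomN_pos K j
    have h3 : (geomN K i : ℝ) ≤ (16 ^ K : ℝ) ^ 2 * geomN K j := by
      exact_mod_cast geomN_le (K := K) (i := i) (j := j) (e := 2) (by omega)
    rw [if_pos hj]
    calc 1 / (4 ^ K * (16 ^ K : ℝ) ^ 3 * geomN K j) * geomN K i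
        ≤ 1 / (4 ^ K * (16 ^ K : ℝ) ^ 3 * geomN K j) * ((16 ^ K : ℝ) ^ 2 * geomN K j) := by gcongr
      _ = 1 / (4 ^ K * 16 ^ K) := by field_simp
  two_delta_le := by
    have h1 : (1 : ℝ) / (4 ^ K * 16 ^ K) ≤ (3 / 4) ^ K := by
      rw [div_le_iff₀ (by positivity), ← mul_pow, ← mul_pow]
      exact one_le_pow₀ (by norm_num)
    linarith
  top_le i hi hi' := by
    have h2 : (geomN K i : ℝ) ≠ 0 := by exact_mod_cast (geomN_pos K i).ne'
    rw [if_pos hi, div_mul_cancel₀ _ h2]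
    have h3 : ((3 : ℝ) / 4) ^ (i + 2) ≤ (3 / 4) ^ K :=
      pow_le_pow_of_le_one (by norm_num) (by norm_num) hi'
    have h4 : (0 : ℝ) ≤ (3 / 4) ^ i := by positivity
    rw [pow_add] at h3
    linarith
  rho_nonneg := by positivity
  M_pos i _ := by
    have := geomN_pos K i
    positivity
  first_lt j hj := by
    have hX : (16 : ℝ) ≤ 16 ^ (K - (j + 1)) := by
      calc (16 : ℝ) = 16 ^ 1 := by norm_num
        _ ≤ _ := pow_le_pow_right₀ (by norm_num) (by omega)
    have hMw : ∀ i, i ≤ K → ((20 * 16 ^ (K - i) * 4 ^ K * (16 ^ K) ^ 3 * geomN K i : ℕ) : ℝ) *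
        (if i ≤ K then 1 / (4 ^ K * (16 ^ K) ^ 3 * (geomN K i : ℝ)) else 0) =
        20 * 16 ^ (K - i) := by
      intro i hi
      have : (geomN K i : ℝ) ≠ 0 := by exact_mod_cast (geomN_pos K i).ne'
      rw [if_pos hi]
      push_cast
      field_simp
    have h1 : ∑ i ∈ Finset.range (K + 1), (geomN K i : ℝ) * (((16 ^ K) ^ 3 : ℕ) * (if i ≤ K then
        1 / (4 ^ K * (16 ^ K) ^ 3 * (geomN K i : ℝ)) else 0) +
        (if i ≤ K then (3 / 4) ^ i / (geomN K i : ℝ) else 0)) ≤ 5 := by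
      have : ∀ i ∈ Finset.range (K + 1), (geomN K i : ℝ) * (((16 ^ K) ^ 3 : ℕ) * (if i ≤ K then
          1 / (4 ^ K * (16 ^ K) ^ 3 * (geomN K i : ℝ)) else 0) +
          (if i ≤ K then (3 / 4) ^ i / (geomN K i : ℝ) else 0)) = 1 / 4 ^ K + (3 / 4) ^ i := by
        intro i hi
        have hi' : i ≤ K := by simpa [Nat.lt_succ_iff] using hi
        have h0 : (geomN K i : ℝ) ≠ 0 := by exact_mod_cast (geomN_pos K i).ne'
        rw [mul_add, geom_mul_w hi', if_pos hi', mul_div_cancel₀ _ h0]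
      rw [Finset.sum_congr rfl this, Finset.sum_add_distrib]
      have h2 : ((K : ℝ) + 1) * (1 / 4 ^ K) ≤ 1 := by
        rw [mul_one_div, div_le_one (by positivity)]
        exact_mod_cast Nat.lt_pow_self (by norm_num : 1 < 4)
      have h3 := sum_three_quarters_pow_le (K + 1)
      simp only [Finset.sum_const, Finset.card_range, nsmul_eq_mul]
      push_cast
      linarith
    have h2 : ∑ i ∈ Finset.range (K + 1),
        ((20 * 16 ^ (K - i) * 4 ^ K * (16 ^ K) ^ 3 * geomN K i : ℕ) : ℝ) *
        (if i ≤ j + 1 then 0 else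
          2 * (if i ≤ K then 1 / (4 ^ K * (16 ^ K) ^ 3 * (geomN K i : ℝ)) else 0)) ≤
        8 / 3 * 16 ^ (K - (j + 1)) := by
      refine le_trans (le_of_eq (Finset.sum_congr rfl fun i hi => ?_))
        (sum_sixteen_pow_le (K := K) (m := j + 1) (by omega))
      have hi' : i ≤ K := by simpa [Nat.lt_succ_iff] using hi
      split_ifs with h
      · simp
      · have := hMw i hi'
        rw [if_pos hi'] at this
        linear_combination 2 * this
    have h3 := hMw (j + 1) (by omega)
    rw [h3]
    linarith
  later_lt j hj := by
    have hNr : ∀ i, i ≤ K → (geomN K i : ℝ) *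
        (if i ≤ K then (3 / 4) ^ i / (geomN K i : ℝ) else 0) = (3 / 4) ^ i := by
      intro i hi
      have h0 : (geomN K i : ℝ) ≠ 0 := by exact_mod_cast (geomN_pos K i).ne'
      rw [if_pos hi, mul_div_cancel₀ _ h0]
    rw [hNr j (by omega), hNr (j + 1) (by omega), hNr (j + 3) (by omega),
      Finset.sum_congr rfl fun i hi => geom_mul_w (by simpa [Nat.lt_succ_iff] using hi)]
    simp only [Finset.sum_const, Finset.card_range, nsmul_eq_mul]
    have h1 : (1 : ℝ) / (4 ^ K * 16 ^ K) ≤ 1 / 4 ^ K := by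
      gcongr
      exact le_mul_of_one_le_right (by positivity) (one_le_pow₀ (by norm_num))
    have h2 : (6 * (K + 2) : ℝ) * (1 / 4 ^ K) < (3 / 4) ^ K := by
      rw [div_pow, mul_one_div]
      gcongr
      exact_mod_cast six_mul_lt_three_pow hK
    have h3 : ((3 : ℝ) / 4) ^ K ≤ (3 / 4) ^ j :=
      pow_le_pow_of_le_one (by norm_num) (by norm_num) (by omega)
    have h4 : (0 : ℝ) < (3 / 4) ^ K := by positivity
    rw [pow_add _ j 1, pow_add _ j 3]
    push_cast
    nlinarith

/-! ### Labellings -/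

theorem exists_card_fiber_eq {Λ : Type} [Fintype Λ] [DecidableEq Λ] {n : ℕ} (size : Λ → ℕ)
    (h : ∑ l, size l ≤ n) :
    ∃ F : Fin n → Option Λ, ∀ l, (Finset.univ.filter fun x => F x = some l).card = size l := by
  classical
  have hcard : Fintype.card (Σ l, Fin (size l)) ≤ Fintype.card (Fin n) := by simpa using h
  obtain ⟨e⟩ := Function.Embedding.nonempty_of_card_le hcard
  have he := e.injective.isPartialInv
  refine ⟨fun x => (Function.partialInv e x).map Sigma.fst, fun l => ?_⟩
  have : (Finset.univ.filter fun x => (Function.partialInv e x).map Sigma.fst = some l) =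
      (Finset.univ : Finset (Fin (size l))).map
        ((Function.Embedding.sigmaMk l).trans e) := by
    ext x
    simp only [Finset.mem_filter, Finset.mem_univ, true_and, Option.map_eq_some_iff,
      Finset.mem_map, Function.Embedding.trans_apply, Function.Embedding.sigmaMk_apply]
    constructor
    · rintro ⟨⟨l', t⟩, h1, rfl⟩
      exact ⟨t, (he _ _).1 h1⟩
    · rintro ⟨t, ht⟩
      exact ⟨⟨l, t⟩, (he _ _).2 ht, rfl⟩
  rw [this, Finset.card_map, Finset.card_univ, Fintype.card_fin]

theorem exists_isLabelling {K g : ℕ} (D : LevelScheme K g) {n : ℕ}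
    (h : ∑ i ∈ Finset.range (K + 1), (D.M i + g * D.N i) ≤ n) :
    ∃ lab : Fin n → ℕ × Option (Fin g), D.IsLabelling lab := by
  classical
  obtain ⟨F, hF⟩ := exists_card_fiber_eq (Λ := Fin (K + 1) × Option (Fin g)) (n := n)
    (fun l => if l.2 = none then D.M l.1 else D.N l.1) (by
      rw [Fintype.sum_prod_type]
      simp only [Fintype.sum_option]
      simp only [if_true, reduceCtorEq, if_false, Finset.sum_const, Finset.card_univ,
        Fintype.card_fin, smul_eq_mul]
      rwa [Fin.sum_univ_eq_sum_range (fun i => D.M i + g * D.N i)])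
  have key : ∀ i (hi : i ≤ K) o, (Finset.univ.filter fun x =>
      ((F x).elim (K + 1, none) fun l => ((l.1 : ℕ), l.2)) = (i, o)).card =
      if o = none then D.M i else D.N i := by
    intro i hi o
    rw [← hF (⟨i, by omega⟩, o)]
    congr 1
    ext x
    simp only [Finset.mem_filter, Finset.mem_univ, true_and]
    cases hx : F x with
    | none =>
      simp
      omega
    | some l =>
      rcases l with ⟨l1, l2⟩
      simp [Fin.ext_iff]
  refine ⟨fun x => (F x).elim (K + 1, none) fun l => ((l.1 : ℕ), l.2), fun i hi b => ?_,
    fun i hi => ?_⟩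
  · simpa using key i hi (some b)
  · simpa using key i hi none

theorem geom_card_le {K : ℕ} (hK : 4 ≤ K) :
    ∑ i ∈ Finset.range (K + 1), ((geom K hK).M i + (16 ^ K) ^ 3 * (geom K hK).N i) ≤
      2 ^ (16 * K ^ 2) := by
  have hN : ∀ i, geomN K i ≤ (16 ^ K) ^ (2 * K) := fun i =>
    Nat.pow_le_pow_right (by positivity) (by omega)
  have h1 : ∀ i ∈ Finset.range (K + 1), (geom K hK).M i + (16 ^ K) ^ 3 * (geom K hK).N i ≤
      21 * 16 ^ K * 4 ^ K * (16 ^ K) ^ 3 * (16 ^ K) ^ (2 * K) := by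
    intro i _
    have h2 : (geom K hK).M i ≤ 20 * 16 ^ K * 4 ^ K * (16 ^ K) ^ 3 * (16 ^ K) ^ (2 * K) := by
      change 20 * 16 ^ (K - i) * 4 ^ K * (16 ^ K) ^ 3 * geomN K i ≤ _
      gcongr
      · norm_num
      · omega
      · exact hN i
    have h3 : (16 ^ K) ^ 3 * (geom K hK).N i ≤
        16 ^ K * 4 ^ K * (16 ^ K) ^ 3 * (16 ^ K) ^ (2 * K) := by
      refine Nat.mul_le_mul ?_ (hN i)
      exact Nat.le_mul_of_pos_left _ (by positivity)
    linarith
  refine (Finset.sum_le_card_nsmul _ _ _ h1).trans ?_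
  rw [Finset.card_range, smul_eq_mul]
  have h4 : (K + 1) * 21 ≤ 2 ^ K * 2 ^ 5 :=
    Nat.mul_le_mul (Nat.lt_pow_self (by norm_num)) (by norm_num)
  calc (K + 1) * (21 * 16 ^ K * 4 ^ K * (16 ^ K) ^ 3 * (16 ^ K) ^ (2 * K))
      = (K + 1) * 21 * (16 ^ K * 4 ^ K * (16 ^ K) ^ 3 * (16 ^ K) ^ (2 * K)) := by ring
    _ ≤ 2 ^ K * 2 ^ 5 * (16 ^ K * 4 ^ K * (16 ^ K) ^ 3 * (16 ^ K) ^ (2 * K)) := by gcongr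
    _ = 2 ^ (K + 5 + (4 * K + (2 * K + (4 * K * 3 + 4 * K * (2 * K))))) := by
      rw [show (16 : ℕ) = 2 ^ 4 by norm_num, show (4 : ℕ) = 2 ^ 2 by norm_num]
      simp only [← pow_mul, ← pow_add]
      congr 1
      ring
    _ ≤ 2 ^ (16 * K ^ 2) := Nat.pow_le_pow_right (by norm_num) (by nlinarith)

/-! ### The gap -/

/-- The instances of the geometric scheme have the gap `(8 / 7) ^ K`. -/
theorem staticUniformGap_geom {K : ℕ} (hK : 4 ≤ K)
    (hK' : 3 * ((K : ℝ) + 1) * (6 / 7) ^ K ≤ 1) {n : ℕ}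
    {lab : Fin n → ℕ × Option (Fin ((16 ^ K) ^ 3))} (hlab : (geom K hK).IsLabelling lab)
    {C : Fin ((16 ^ K) ^ 3) → Finset (Fin ((16 ^ K) ^ 3))} (hC : HasFreshLabels C)
    (hmem : ∀ b, b ∈ C b) {α : ℝ} (hα : 0 < α) (hαK : α ≤ (8 / 7) ^ K) :
    StaticUniformGap (fun b => (geom K hK).valuation lab (C b) ⟨b, hmem b⟩) α := by
  have hopt := le_opt hlab (hCne := fun b => ⟨b, hmem b⟩) hmem
  have hone : ((geom K hK).N 0 : ℝ) * (geom K hK).r 0 = 1 := by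
    have h0 : (geomN K 0 : ℝ) ≠ 0 := by exact_mod_cast (geomN_pos K 0).ne'
    change (geomN K 0 : ℝ) * (if 0 ≤ K then (3 / 4) ^ 0 / (geomN K 0 : ℝ) else 0) = 1
    rw [if_pos (Nat.zero_le _), pow_zero, mul_one_div_cancel h0]
  rw [hone, mul_one] at hopt
  push_cast at hopt
  have hg : (0 : ℝ) < (16 ^ K) ^ 3 := by positivity
  refine ⟨lt_of_lt_of_le hg hopt, fun σ p hp B hB => ?_⟩
  have hrev := revenue_le (by omega) hlab hC hp hB
  have hsum : ∑ i ∈ Finset.range (K + 1), 2 * (geom K hK).w i *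
      ((geom K hK).M i + ((16 ^ K) ^ 3 : ℕ) * (geom K hK).N i) ≤ (K + 1) * (42 * 16 ^ K) := by
    refine (Finset.sum_le_card_nsmul _ _ (42 * 16 ^ K) fun i hi => ?_).trans_eq (by simp)
    have hi' : i ≤ K := by simpa [Nat.lt_succ_iff] using hi
    have h0 : (geomN K i : ℝ) ≠ 0 := by exact_mod_cast (geomN_pos K i).ne'
    have h1 : 2 * (geom K hK).w i * ((geom K hK).M i + ((16 ^ K) ^ 3 : ℕ) * (geom K hK).N i) =
        40 * 16 ^ (K - i) + 2 * (1 / 4 ^ K) := by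
      change 2 * (if i ≤ K then 1 / (4 ^ K * (16 ^ K) ^ 3 * (geomN K i : ℝ)) else 0) *
        (((20 * 16 ^ (K - i) * 4 ^ K * (16 ^ K) ^ 3 * geomN K i : ℕ) : ℝ) +
          ((16 ^ K) ^ 3 : ℕ) * (geomN K i : ℝ)) = _
      rw [if_pos hi']
      push_cast
      field_simp
      ring
    rw [h1]
    have h2 : (16 : ℝ) ^ (K - i) ≤ 16 ^ K := pow_le_pow_right₀ (by norm_num) (by omega)
    have h3 : (1 : ℝ) / 4 ^ K ≤ 1 := by
      rw [div_le_one (by positivity)]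
      exact one_le_pow₀ (by norm_num)
    have h4 : (1 : ℝ) ≤ 16 ^ K := one_le_pow₀ (by norm_num)
    linarith
  have hρ : (geom K hK).ρ = 2 * (3 / 4) ^ K := rfl
  rw [hρ] at hrev
  push_cast at hrev hsum
  have h42 : (42 : ℝ) * 16 ^ K ≤ (16 ^ K) ^ 3 * (3 / 4) ^ K := by
    have h1 : ((16 : ℝ) ^ K) ^ 3 * (3 / 4) ^ K = 192 ^ K * 16 ^ K := by
      rw [← pow_mul, mul_comm K 3, pow_mul, ← mul_pow, ← mul_pow]
      norm_num
    rw [h1]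
    gcongr
    calc (42 : ℝ) ≤ 192 ^ 1 := by norm_num
      _ ≤ 192 ^ K := pow_le_pow_right₀ (by norm_num) (by omega)
  rw [le_div_iff₀ hα]
  have hrev' : revenue (fun _ => p) B ≤ (16 ^ K) ^ 3 * (3 * (K + 1) * (3 / 4) ^ K) := by
    have : ((K : ℝ) + 1) * (42 * 16 ^ K) ≤ (K + 1) * ((16 ^ K) ^ 3 * (3 / 4) ^ K) := by gcongr
    linarith
  calc revenue (fun _ => p) B * α
      ≤ (16 ^ K) ^ 3 * (3 * (K + 1) * (3 / 4) ^ K) * (8 / 7) ^ K := by gcongr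
    _ = (16 ^ K) ^ 3 * (3 * (K + 1) * (6 / 7) ^ K) := by
      rw [mul_assoc, mul_assoc _ _ ((8 / 7 : ℝ) ^ K), ← mul_pow]
      norm_num
    _ ≤ (16 ^ K) ^ 3 * 1 := by gcongr
    _ ≤ _ := by rw [mul_one]; exact hopt

end LevelScheme

open LevelScheme in
/-- If the scheme fits into `n` items, the surplus items being worthless, then both kinds of
instances with the gap `(8 / 7) ^ K` exist. -/
theorem exists_gap_instances {K n : ℕ} (hK : 4 ≤ K)
    (hK' : 3 * ((K : ℝ) + 1) * (6 / 7) ^ K ≤ 1) (hn : 2 ^ (16 * K ^ 2) ≤ n) {α : ℝ} (hα : 0 < α)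
    (hαK : α ≤ (8 / 7) ^ K) :
    (∃ (m : ℕ) (v : Fin m → Valuation (Fin n)), (∀ b, IsMaxOfAdditive 2 (v b)) ∧
      StaticUniformGap v α) ∧
    ∃ (m : ℕ) (v : Fin m → Valuation (Fin n)), (∀ b, IsXOS (v b)) ∧ (∀ b b', v b = v b') ∧
      StaticUniformGap v α := by
  obtain ⟨lab, hlab⟩ := (geom K hK).exists_isLabelling ((geom_card_le hK).trans hn)
  refine ⟨⟨_, _, fun b => ?_, staticUniformGap_geom hK hK' hlab hasFreshLabels_singleton
      (fun b => Finset.mem_singleton_self b) hα hαK⟩,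
    ⟨_, fun b => (geom K hK).valuation lab Finset.univ ⟨b, Finset.mem_univ b⟩,
      fun b => ⟨_, isMaxOfAdditive_valuation _ _ _ _⟩, fun b b' => rfl,
      staticUniformGap_geom hK hK' hlab hasFreshLabels_univ (fun b => Finset.mem_univ b) hα hαK⟩⟩
  simpa using (geom K hK).isMaxOfAdditive_valuation lab {b} ⟨b, Finset.mem_singleton_self b⟩

/-- The largest `K` for which the scheme fits into `n` items still gives a gap exponential in
`√(log n)`. -/
theorem two_rpow_sqrt_log_le {K n : ℕ} (hK : 1 ≤ K) (hn : n < 2 ^ (16 * (K + 1) ^ 2)) :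
    (2 : ℝ) ^ ((1 / 64 : ℝ) * √(Real.log n)) ≤ (8 / 7) ^ K := by
  have hlog : Real.log n ≤ (4 * (K + 1)) ^ 2 := by
    rcases Nat.eq_zero_or_pos n with rfl | hpos
    · simp
      positivity
    · have h1 : (n : ℝ) ≤ 2 ^ (16 * (K + 1) ^ 2) := by exact_mod_cast hn.le
      have h2 := Real.log_le_log (by exact_mod_cast hpos) h1
      rw [Real.log_pow] at h2
      have h3 : Real.log 2 ≤ 1 := by linarith [Real.log_two_lt_d9]
      refine h2.trans ((mul_le_mul_of_nonneg_left h3 (Nat.cast_nonneg _)).trans_eq ?_)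
      push_cast
      ring
  have hK1 : (1 : ℝ) ≤ K := by exact_mod_cast hK
  have hsqrt : √(Real.log n) ≤ 8 * K :=
    (Real.sqrt_le_iff.2 ⟨by positivity, hlog⟩).trans (by linarith)
  have h8 : (2 : ℝ) ^ (1 / 8 : ℝ) ≤ 8 / 7 := by
    have h1 := Real.pow_rpow_inv_natCast (x := 8 / 7) (n := 8) (by norm_num) (by norm_num)
    rw [← h1, one_div]
    exact Real.rpow_le_rpow (by norm_num) (by norm_num) (by norm_num)
  calc (2 : ℝ) ^ ((1 / 64 : ℝ) * √(Real.log n)) ≤ 2 ^ ((1 / 8 : ℝ) * K) :=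
        Real.rpow_le_rpow_of_exponent_le (by norm_num) (by linarith)
    _ = ((2 : ℝ) ^ (1 / 8 : ℝ)) ^ K := by rw [Real.rpow_mul (by norm_num), Real.rpow_natCast]
    _ ≤ (8 / 7) ^ K := by gcongr

theorem eventually_three_mul_le :
    ∀ᶠ K : ℕ in Filter.atTop, 3 * ((K : ℝ) + 1) * (6 / 7) ^ K ≤ 1 := by
  have h1 := tendsto_self_mul_const_pow_of_lt_one (r := (6 / 7 : ℝ)) (by norm_num) (by norm_num)
  have h2 := tendsto_pow_atTop_nhds_zero_of_lt_one (r := (6 / 7 : ℝ)) (by norm_num) (by norm_num)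
  have h3 := (h1.add h2).const_mul 3
  simp only [add_zero, mul_zero] at h3
  filter_upwards [h3.eventually (eventually_le_nhds (zero_lt_one' ℝ))] with K hK
  linarith

end ItemPricing

theorem theorem3p1 :
    ∃ c : ℝ, 0 < c ∧ ∃ N : ℕ, ∀ n : ℕ, N ≤ n →
      (∃ (m : ℕ) (v : Fin m → ItemPricing.Valuation (Fin n)),
        (∀ b, ItemPricing.IsXOS (v b)) ∧
        ItemPricing.StaticUniformGap v ((2 : ℝ) ^ (c * √(Real.log (n : ℝ))))) ∧
      (∃ (m : ℕ) (v : Fin m → ItemPricing.Valuation (Fin n)),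
        (∀ b, ItemPricing.IsXOSOfWidth 3 (v b)) ∧
        ItemPricing.StaticUniformGap v ((2 : ℝ) ^ (c * √(Real.log (n : ℝ))))) ∧
      (∃ (m : ℕ) (v : Fin m → ItemPricing.Valuation (Fin n)),
        (∀ b, ItemPricing.IsXOS (v b)) ∧ (∀ b b', v b = v b') ∧
        ItemPricing.StaticUniformGap v ((2 : ℝ) ^ (c * √(Real.log (n : ℝ))))) := by
  obtain ⟨K₀, hK₀⟩ := Filter.eventually_atTop.1
    (ItemPricing.eventually_three_mul_le.and (Filter.eventually_ge_atTop 4))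
  refine ⟨1 / 64, by norm_num, 2 ^ (16 * K₀ ^ 2), fun n hn => ?_⟩
  set K := Nat.sqrt (Nat.log 2 n) / 4 with hKdef
  have hn0 : n ≠ 0 := ((by positivity : 0 < 2 ^ (16 * K₀ ^ 2)).trans_le hn).ne'
  have hK₀K : K₀ ≤ K := by
    have h1 : 16 * K₀ ^ 2 ≤ Nat.log 2 n := Nat.le_log_of_pow_le (by norm_num) hn
    have h2 : 4 * K₀ ≤ Nat.sqrt (Nat.log 2 n) := Nat.le_sqrt'.2 (by nlinarith)
    omega
  obtain ⟨hK1, hK4⟩ := hK₀ K hK₀K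
  have hlow : 2 ^ (16 * K ^ 2) ≤ n := by
    have h1 : 4 * K ≤ Nat.sqrt (Nat.log 2 n) := Nat.mul_div_le _ _
    have h2 := Nat.le_sqrt'.1 h1
    exact (Nat.pow_le_pow_right (by norm_num) (by nlinarith)).trans (Nat.pow_log_le_self 2 hn0)
  have hupp : n < 2 ^ (16 * (K + 1) ^ 2) := by
    have h1 : Nat.sqrt (Nat.log 2 n) < 4 * (K + 1) := by omega
    have h2 := Nat.sqrt_lt'.1 h1
    exact (Nat.lt_pow_succ_log_self (by norm_num) n).trans_le
      (Nat.pow_le_pow_right (by norm_num) (by nlinarith))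
  obtain ⟨⟨m, v, hv, hgap⟩, hid⟩ := ItemPricing.exists_gap_instances hK4 hK1 hlow
    (α := (2 : ℝ) ^ ((1 / 64 : ℝ) * √(Real.log (n : ℝ)))) (by positivity)
    (ItemPricing.two_rpow_sqrt_log_le (by omega) hupp)
  exact ⟨⟨m, v, fun b => ⟨2, hv b⟩, hgap⟩, ⟨m, v, fun b => ⟨2, by norm_num, hv b⟩, hgap⟩, hid⟩
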